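/- Let $A\in\mathbb{R}^{n\times m}$ and denote all its nonzero singular values (with multiplicity) by $\sigma_1(A)\ge\dots\ge\sigma_{\operatorname{rank}(A)}(A)>0$. Let $W\in\mathbb{R}^{m\times m}$ be a diagonal matrix whose diagonal entries are all nonzero. Then for all integers $k,r$ with $1\le k\le r\le\operatorname{rank}(A)$ there exists a subset $\mathcal S\subseteq\{1,\dots,m\}$ of size $k$ such that $$\sigma_{\min}(A_{\mathcal S}W_{\mathcal S})^2\;\ge\;\frac{(\sqrt r-\sqrt{k-1})^2}{\|W^{-1}\|_F^2}\cdot\frac{r}{\sum_{i=1}^{r}\sigma_i(A)^{-2}}.$$ Here $A_{\mathcal S}$ is the $n\times k$ submatrix of $A$ formed by the columns indexed by $\mathcal S$, $W_{\mathcal S}$ is the $k\times k$ diagonal submatrix of $W$ with rows and columns indexed by $\mathcal S$, $\sigma_{\min}(B)=\min_{\|x\|_2=1}\|Bx\|_2$ is the least singular value, and $\|\cdot\|_F$ is the Frobenius norm. -/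

import Mathlib

noncomputable section

namespace RestrictedInvertibility

/-- `σ_i(A)`, the `i`-th largest singular value of a real matrix `A` acting between Euclidean
spaces, with multiplicity and indexed from `0`; the first `rank A` of them are the nonzero ones. -/
def singularValue {n m : ℕ} (A : Matrix (Fin n) (Fin m) ℝ) (i : ℕ) : ℝ :=
  (Matrix.toEuclideanLin A).singularValues i

/-- The least singular value `σ_min(B) = min_{‖x‖₂ = 1} ‖B x‖₂`. The minimum is attained, by
compactness of the unit sphere, whenever `B` has at least one column. -/
def sigmaMin {m ι : Type*} [Fintype m] [Fintype ι] [DecidableEq ι] (B : Matrix m ι ℝ) : ℝ :=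
  ⨅ x : Metric.sphere (0 : EuclideanSpace ℝ ι) 1, ‖Matrix.toEuclideanLin B x‖

/-- `A_S`: the columns of `A` indexed by `S`. -/
def columns {n m : ℕ} (A : Matrix (Fin n) (Fin m) ℝ) (S : Finset (Fin m)) :
    Matrix (Fin n) S ℝ :=
  A.submatrix id Subtype.val

/-- `W_S`: the principal submatrix of a square matrix with rows and columns indexed by `S`. -/
def principal {m : ℕ} (W : Matrix (Fin m) (Fin m) ℝ) (S : Finset (Fin m)) : Matrix S S ℝ :=
  W.submatrix Subtype.val Subtype.val

open scoped Matrix.Norms.Frobenius in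
/-- The Frobenius norm of a real matrix. -/
def frobeniusNorm {n m : ℕ} (A : Matrix (Fin n) (Fin m) ℝ) : ℝ := ‖A‖

end RestrictedInvertibility

end

/-! Let `e i` be the right singular vectors for the `r` largest singular values, and put `v c i = W
c c * e i c`. With weights `p c = (W c c)⁻²`, of total `Z = ‖W⁻¹‖_F²`, orthonormality says `∑ p c •
v c (v c)ᵀ = 1`. So the vectors `√Z • v c`, drawn with probability `p c / Z`, are isotropic in
dimension `r`.

Start from the negative diagonal matrix with entries `-ν i`, `ν i = b / σ i ^ 2`, and add `k` of
these rank-one matrices so that `k` eigenvalues become positive. The updated form is then positive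
on a `k`-dimensional space. This forces the `k` chosen indices to be distinct, lets every `z` be
written as `(v c ⬝ᵥ x)` over the chosen `c`, and bounds `b ∑ x i ^ 2 / σ i ^ 2` by `Z ‖z‖²`.
Cauchy-Schwarz turns this into `b ‖z‖² ≤ Z ‖A W z‖²` (`exists_subset_of_isotropic`).

The updates are chosen greedily. An isotropic update acts on the expected characteristic polynomial
as `1 - d/dx` (`sum_charpoly_add_vecMulVec`), so some choice preserves the sign at `0` of the
polynomial expected at the end. That sign fixes the parity of the number of positive roots, and Weyl
monotonicity leaves only two consecutive values for it, so the number itself is preserved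
(`exists_list_posCount`).

It remains to know the sign of `(1 - d/dx) ^ j ∏ (x + ν i)` at `0`. By duality this is the value at
`1` of `∏ (ν i - d/dx) x ^ j` (`eval_iterate_sub_derivative`). A lower barrier argument places all
`j` roots of the latter beyond `1`, and optimizing the barrier height gives the constant `(√r - √(k
- 1))²`. -/

namespace RestrictedInvertibility

open Matrix Polynomial

/-! ### Quadratic forms and eigenvalues under rank-one updates. -/

variable {ι κ : Type*} [Fintype ι]

/-- The monic polynomial with roots `lam i`. -/
noncomputable def rootsPoly [Fintype κ] (lam : κ → ℝ) : ℝ[X] := ∏ i, (X - C (lam i))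

/-- The number of positive entries of a real vector. -/
noncomputable def posCount [Fintype κ] (lam : κ → ℝ) : ℕ :=
  (Finset.univ.filter fun i => 0 < lam i).card

theorem posCount_mono {lam lam' : ι → ℝ} (h : lam ≤ lam') : posCount lam ≤ posCount lam' :=
  Finset.card_le_card fun i hi => by
    simp only [Finset.mem_filter, Finset.mem_univ, true_and] at hi ⊢
    exact hi.trans_le (h i)

theorem isHermitian_add_vecMulVec {A : Matrix κ κ ℝ} (hA : A.IsHermitian) (u : κ → ℝ) :
    (A + vecMulVec u u).IsHermitian := by
  refine hA.add ?_
  ext i j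
  simp [vecMulVec_apply, mul_comm]

theorem dotProduct_vecMulVec_mulVec (u x : ι → ℝ) :
    x ⬝ᵥ (vecMulVec u u *ᵥ x) = (u ⬝ᵥ x) ^ 2 := by
  rw [vecMulVec_mulVec]
  simp [dotProduct_smul, dotProduct_comm x u, sq]

theorem sum_repr_sq_eq {E : Type*} [NormedAddCommGroup E] [InnerProductSpace ℝ E]
    (a : OrthonormalBasis ι ℝ E) (x : E) : ∑ i, (a.repr x i) ^ 2 = ‖x‖ ^ 2 := by
  rw [← a.repr.norm_map x, EuclideanSpace.norm_sq_eq]; simp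

theorem sum_repr_sq_pos {E : Type*} [NormedAddCommGroup E] [InnerProductSpace ℝ E]
    (a : OrthonormalBasis ι ℝ E) {x : E} (hx : x ≠ 0) : 0 < ∑ i, (a.repr x i) ^ 2 := by
  rw [sum_repr_sq_eq]; positivity

variable [DecidableEq ι]

/-- The quadratic form of a symmetric matrix in an eigenbasis. -/
theorem dotProduct_mulVec_eq_sum_eigenvalues {A : Matrix ι ι ℝ} (hA : A.IsHermitian)
    (x : EuclideanSpace ℝ ι) :
    x.ofLp ⬝ᵥ (A *ᵥ x.ofLp) = ∑ i, hA.eigenvalues i * (hA.eigenvectorBasis.repr x i) ^ 2 := by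
  have h1 : A *ᵥ x.ofLp =
      (∑ i, (hA.eigenvectorBasis.repr x i * hA.eigenvalues i) • hA.eigenvectorBasis i :
        EuclideanSpace ℝ ι).ofLp := by
    conv_lhs => rw [← hA.eigenvectorBasis.sum_repr x]
    simp only [WithLp.ofLp_sum, WithLp.ofLp_smul, Matrix.mulVec_sum, Matrix.mulVec_smul,
      hA.mulVec_eigenvectorBasis, smul_smul]
  have h2 : ∀ y : EuclideanSpace ℝ ι, x.ofLp ⬝ᵥ y.ofLp = inner ℝ x y := fun y => by
    rw [EuclideanSpace.inner_eq_star_dotProduct, dotProduct_comm]; simp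
  rw [h1, h2, inner_sum]
  refine Finset.sum_congr rfl fun i _ => ?_
  rw [inner_smul_right, OrthonormalBasis.repr_apply_apply, real_inner_comm]
  ring

/-- A dimension count for vectors supported on prescribed coordinates of two bases and subject to
further linear conditions. -/
theorem exists_ne_zero_of_card_lt {E V : Type*} [NormedAddCommGroup E] [InnerProductSpace ℝ E]
    [AddCommGroup V] [Module ℝ V] [FiniteDimensional ℝ V]
    (a b : OrthonormalBasis ι ℝ E) (f : E →ₗ[ℝ] V) (s t : Finset ι)
    (h : Fintype.card ι + Module.finrank ℝ V < s.card + t.card) :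
    ∃ x : E, x ≠ 0 ∧ f x = 0 ∧ (∀ i ∉ s, a.repr x i = 0) ∧ ∀ i ∉ t, b.repr x i = 0 := by
  have : FiniteDimensional ℝ E := a.toBasis.finiteDimensional_of_finite
  let ga : E →ₗ[ℝ] ({i // i ∉ s} → ℝ) :=
    LinearMap.pi fun i => (innerₛₗ ℝ (a i))
  let gb : E →ₗ[ℝ] ({i // i ∉ t} → ℝ) :=
    LinearMap.pi fun i => (innerₛₗ ℝ (b i))
  have hlt : Module.finrank ℝ (V × (({i // i ∉ s} → ℝ) × ({i // i ∉ t} → ℝ))) <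
      Module.finrank ℝ E := by
    rw [Module.finrank_eq_card_basis a.toBasis]
    simp only [Module.finrank_prod, Module.finrank_fintype_fun_eq_card, Fintype.card_subtype_compl,
      Fintype.card_coe]
    have := Finset.card_le_univ s
    have := Finset.card_le_univ t
    omega
  have hker := LinearMap.ker_ne_bot_of_finrank_lt (f := f.prod (ga.prod gb)) hlt
  obtain ⟨x, hx, hx0⟩ := Submodule.exists_mem_ne_zero_of_ne_bot hker
  simp only [LinearMap.mem_ker, LinearMap.prod_apply, Function.prod_apply, Prod.mk_eq_zero] at hx
  refine ⟨x, hx0, hx.1, fun i hi => ?_, fun i hi => ?_⟩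
  · simpa [OrthonormalBasis.repr_apply_apply, ga] using congrFun hx.2.1 ⟨i, hi⟩
  · simpa [OrthonormalBasis.repr_apply_apply, gb] using congrFun hx.2.2 ⟨i, hi⟩

/-- **Weyl's monotonicity principle**. -/
theorem eigenvalues_mono {A B : Matrix ι ι ℝ} (hA : A.IsHermitian) (hB : B.IsHermitian)
    (h : ∀ x, x ⬝ᵥ (A *ᵥ x) ≤ x ⬝ᵥ (B *ᵥ x)) : hA.eigenvalues ≤ hB.eigenvalues := by
  intro i
  by_contra! hlt
  set s := Finset.univ.filter fun j => hA.eigenvalues i ≤ hA.eigenvalues j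
  set t := Finset.univ.filter fun j => hB.eigenvalues j ≤ hB.eigenvalues i
  -- Both eigenvalue families are sorted by the same enumeration, so each index lies in `s` or `t`,
  -- while `i` lies in both. The two eigenspaces therefore meet, with no extra linear condition
  -- imposed (`Fin 0 → ℝ`).
  have hun : s ∪ t = Finset.univ := by
    ext j
    simp only [s, t, Finset.mem_union, Finset.mem_filter, Finset.mem_univ, true_and, iff_true]
    rcases le_total ((Fintype.equivOfCardEq (Fintype.card_fin (Fintype.card ι))).symm i)
      ((Fintype.equivOfCardEq (Fintype.card_fin (Fintype.card ι))).symm j) with hij | hij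
    · exact Or.inr (hB.eigenvalues₀_antitone hij)
    · exact Or.inl (hA.eigenvalues₀_antitone hij)
  have hin : 0 < (s ∩ t).card := Finset.card_pos.2 ⟨i, by simp [s, t]⟩
  have hcard := Finset.card_union_add_card_inter s t
  rw [hun, Finset.card_univ] at hcard
  obtain ⟨x, hx0, -, hxs, hxt⟩ := exists_ne_zero_of_card_lt hA.eigenvectorBasis
    hB.eigenvectorBasis (0 : _ →ₗ[ℝ] (Fin 0 → ℝ)) s t (by simp; omega)
  have hq := h x.ofLp
  rw [dotProduct_mulVec_eq_sum_eigenvalues hA, dotProduct_mulVec_eq_sum_eigenvalues hB] at hq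
  have h1 : hA.eigenvalues i * ∑ j, (hA.eigenvectorBasis.repr x j) ^ 2 ≤
      ∑ j, hA.eigenvalues j * (hA.eigenvectorBasis.repr x j) ^ 2 := by
    rw [Finset.mul_sum]
    refine Finset.sum_le_sum fun j _ => ?_
    by_cases hj : j ∈ s
    · exact mul_le_mul_of_nonneg_right (by simpa [s] using hj) (sq_nonneg _)
    · simp [hxs j hj]
  have h2 : ∑ j, hB.eigenvalues j * (hB.eigenvectorBasis.repr x j) ^ 2 ≤
      hB.eigenvalues i * ∑ j, (hB.eigenvectorBasis.repr x j) ^ 2 := by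
    rw [Finset.mul_sum]
    refine Finset.sum_le_sum fun j _ => ?_
    by_cases hj : j ∈ t
    · exact mul_le_mul_of_nonneg_right (by simpa [t] using hj) (sq_nonneg _)
    · simp [hxt j hj]
  have h3 : ∑ j, (hA.eigenvectorBasis.repr x j) ^ 2 = ∑ j, (hB.eigenvectorBasis.repr x j) ^ 2 := by
    rw [sum_repr_sq_eq, sum_repr_sq_eq]
  have h4 := sum_repr_sq_pos hB.eigenvectorBasis hx0
  rw [h3] at h1
  nlinarith

theorem eigenvalues_le_add_vecMulVec {A : Matrix ι ι ℝ} (hA : A.IsHermitian) (u : ι → ℝ) :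
    hA.eigenvalues ≤ (isHermitian_add_vecMulVec hA u).eigenvalues :=
  eigenvalues_mono _ _ fun x => by
    rw [add_mulVec, dotProduct_add, dotProduct_vecMulVec_mulVec]
    nlinarith [sq_nonneg (u ⬝ᵥ x)]

/-- A rank-one update creates at most one new positive eigenvalue. -/
theorem posCount_add_vecMulVec_le {A : Matrix ι ι ℝ} (hA : A.IsHermitian) (u : ι → ℝ) :
    posCount (isHermitian_add_vecMulVec hA u).eigenvalues ≤ posCount hA.eigenvalues + 1 := by
  by_contra! hlt
  set hB := isHermitian_add_vecMulVec hA u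
  set s := Finset.univ.filter fun j => 0 < hB.eigenvalues j
  set t := Finset.univ.filter fun j => ¬ 0 < hA.eigenvalues j
  have hcard := Finset.card_filter_add_card_filter_not (s := (Finset.univ : Finset ι))
    (fun j => 0 < hA.eigenvalues j)
  rw [Finset.card_univ] at hcard
  change _ + t.card = _ at hcard
  change s.card > _ at hlt
  unfold posCount at hlt
  -- The extra condition is orthogonality to `u`, on which the two quadratic forms agree; it costs
  -- the one dimension allowed by the bound.
  obtain ⟨x, hx0, hxu, hxs, hxt⟩ := exists_ne_zero_of_card_lt hB.eigenvectorBasis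
    hA.eigenvectorBasis (innerₛₗ ℝ (WithLp.toLp 2 u : EuclideanSpace ℝ ι)) s t
    (by simp; omega)
  have hux : u ⬝ᵥ x.ofLp = 0 := by
    simpa [EuclideanSpace.inner_eq_star_dotProduct, dotProduct_comm] using hxu
  have hq : x.ofLp ⬝ᵥ ((A + vecMulVec u u) *ᵥ x.ofLp) = x.ofLp ⬝ᵥ (A *ᵥ x.ofLp) := by
    rw [add_mulVec, dotProduct_add, dotProduct_vecMulVec_mulVec, hux]; simp
  rw [dotProduct_mulVec_eq_sum_eigenvalues hA, dotProduct_mulVec_eq_sum_eigenvalues hB] at hq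
  have h1 : ∑ j, hA.eigenvalues j * (hA.eigenvectorBasis.repr x j) ^ 2 ≤ 0 := by
    refine Finset.sum_nonpos fun j _ => ?_
    by_cases hj : j ∈ t
    · exact mul_nonpos_of_nonpos_of_nonneg (by simpa [t] using hj) (sq_nonneg _)
    · simp [hxt j hj]
  have h2 : ∀ j ∈ Finset.univ, 0 ≤ hB.eigenvalues j * (hB.eigenvectorBasis.repr x j) ^ 2 := by
    intro j _
    by_cases hj : j ∈ s
    · exact mul_nonneg (le_of_lt (by simpa [s] using hj)) (sq_nonneg _)
    · simp [hxs j hj]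
  have h3 := (Finset.sum_eq_zero_iff_of_nonneg h2).1
    (le_antisymm (hq.trans_le h1) (Finset.sum_nonneg h2))
  refine (sum_repr_sq_pos hB.eigenvectorBasis hx0).ne' (Finset.sum_eq_zero fun j _ => ?_)
  by_cases hj : j ∈ s
  · exact (mul_eq_zero.1 (h3 j (Finset.mem_univ j))).resolve_left
      (ne_of_gt (by simpa [s] using hj))
  · simp [hxs j hj]

/-! ### Characteristic polynomials of rank-one updates. -/

theorem charpoly_eq_rootsPoly {A : Matrix ι ι ℝ} (hA : A.IsHermitian) :
    A.charpoly = rootsPoly hA.eigenvalues := hA.charpoly_eq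

theorem charpoly_diagonal_eq_rootsPoly (lam : ι → ℝ) :
    (diagonal lam).charpoly = rootsPoly lam := charpoly_diagonal lam

theorem eval_charpoly_add_vecMulVec (A : Matrix ι ι ℝ) (u : ι → ℝ) {t : ℝ}
    (ht : A.charpoly.eval t ≠ 0) :
    (A + vecMulVec u u).charpoly.eval t =
      A.charpoly.eval t * (1 - u ⬝ᵥ ((scalar ι t - A)⁻¹ *ᵥ u)) := by
  rw [eval_charpoly] at ht
  rw [eval_charpoly, eval_charpoly, ← sub_sub]
  have := det_add_replicateCol_mul_replicateRow (ι := Unit) (A := scalar ι t - A)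
    (isUnit_iff_ne_zero.2 ht) (-u) u
  rw [← vecMulVec_eq] at this
  rw [sub_eq_add_neg _ (vecMulVec u u), ← neg_vecMulVec, this,
    det_unique (n := Unit), Matrix.add_apply, one_apply_eq, Matrix.mul_assoc, ← replicateCol_mulVec,
    replicateRow_mul_replicateCol_apply,
    mulVec_neg, dotProduct_neg, ← sub_eq_add_neg]

/-- Jacobi's formula: factor `det (M + s)` as `det M * det (1 + s • M⁻¹)` and take the linear term
in `s`. -/
theorem eval_derivative_charpoly (A : Matrix ι ι ℝ) {t : ℝ} (ht : A.charpoly.eval t ≠ 0) :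
    (derivative A.charpoly).eval t = A.charpoly.eval t * (scalar ι t - A)⁻¹.trace := by
  rw [eval_charpoly] at ht ⊢
  set M := scalar ι t - A with hM
  have h : A.charpoly.comp (X + C t) = C M.det * det (1 + (X : ℝ[X]) • M⁻¹.map C) := by
    refine Polynomial.funext fun s => ?_
    have h1 : (det (1 + (X : ℝ[X]) • M⁻¹.map C)).eval s = det (1 + s • M⁻¹) := by
      rw [← coe_evalRingHom, RingHom.map_det]
      congr 1
      ext i j
      by_cases hij : i = j <;> simp [hij, mul_comm s]
    have h2 : scalar ι (s + t) - A = M * (1 + s • M⁻¹) := by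
      rw [mul_add, mul_one, Matrix.mul_smul, mul_nonsing_inv _ (isUnit_iff_ne_zero.2 ht), hM,
        map_add, smul_one_eq_diagonal, scalar_apply, scalar_apply]
      abel
    rw [eval_mul, h1, eval_C, ← det_mul, ← h2, eval_comp, eval_charpoly]
    simp
  have h2 := congrArg (fun p => (derivative p).eval 0) h
  simpa [derivative_comp, derivative_det_one_add_X_smul] using h2

/-- Allows identities to be checked where the resolvent exists, with `d` the characteristic
polynomial. -/
theorem polynomial_eq_of_eval_eq {p q d : ℝ[X]} (hd : d ≠ 0)
    (h : ∀ t, d.eval t ≠ 0 → p.eval t = q.eval t) : p = q := by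
  have : d * (p - q) = 0 := Polynomial.funext fun t => by
    by_cases ht : d.eval t = 0
    · simp [ht]
    · simp [h t ht]
  exact sub_eq_zero.1 ((mul_eq_zero.1 this).resolve_left hd)

/-- The expected characteristic polynomial of an isotropic random rank-one update. -/
theorem sum_charpoly_add_vecMulVec {α : Type*} [Fintype α] (A : Matrix ι ι ℝ) (p : α → ℝ)
    (u : α → ι → ℝ) (hp : ∑ c, p c = 1) (hu : ∑ c, p c • vecMulVec (u c) (u c) = 1) :
    ∑ c, C (p c) * (A + vecMulVec (u c) (u c)).charpoly =
      A.charpoly - derivative A.charpoly := by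
  refine polynomial_eq_of_eval_eq (charpoly_monic A).ne_zero fun t ht => ?_
  have htr : ∑ c, p c * (u c ⬝ᵥ ((scalar ι t - A)⁻¹ *ᵥ u c)) = (scalar ι t - A)⁻¹.trace := by
    conv_rhs => rw [← mul_one (scalar ι t - A)⁻¹, ← hu, Finset.mul_sum, trace_sum]
    refine Finset.sum_congr rfl fun c _ => ?_
    rw [Matrix.mul_smul, trace_smul, mul_vecMulVec, trace_vecMulVec, dotProduct_comm, smul_eq_mul]
  rw [eval_sub, eval_derivative_charpoly A ht, ← htr, eval_finsetSum]
  simp only [eval_mul, eval_C, eval_charpoly_add_vecMulVec A _ ht]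
  have : ∀ c, p c * (A.charpoly.eval t * (1 - u c ⬝ᵥ ((scalar ι t - A)⁻¹ *ᵥ u c))) =
    A.charpoly.eval t * p c - A.charpoly.eval t * (p c * (u c ⬝ᵥ ((scalar ι t - A)⁻¹ *ᵥ u c))) :=
    fun c => by ring
  simp only [this, Finset.sum_sub_distrib, ← Finset.mul_sum, hp, mul_one]

theorem derivative_rootsPoly_eval [Fintype κ] (lam : κ → ℝ) {t : ℝ} (ht : ∀ i, lam i ≠ t) :
    (derivative (rootsPoly lam)).eval t = -((rootsPoly lam).eval t * ∑ i, (lam i - t)⁻¹) := by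
  classical
  rw [rootsPoly, derivative_prod_finset, eval_finsetSum, Finset.mul_sum, ← Finset.sum_neg_distrib]
  refine Finset.sum_congr rfl fun i hi => ?_
  have h0 : lam i - t ≠ 0 := sub_ne_zero.2 (ht i)
  rw [← Finset.mul_prod_erase _ _ hi]
  simp only [derivative_sub, derivative_X, derivative_C, sub_zero, mul_one, eval_mul, eval_sub,
    eval_X, eval_C]
  field_simp
  ring

/-- The operator `p ↦ p - μ p'` as a rank-one update of a diagonal matrix. -/
theorem charpoly_diagonal_add_vecMulVec (lam : ι → ℝ) (c : ℝ) :
    (diagonal lam + vecMulVec (fun _ => c) (fun _ => c)).charpoly =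
      rootsPoly lam - C (c ^ 2) * derivative (rootsPoly lam) := by
  have hne : rootsPoly lam ≠ 0 := (monic_prod_X_sub_C lam Finset.univ).ne_zero
  refine polynomial_eq_of_eval_eq hne fun t ht => ?_
  have ht' : ∀ i, lam i ≠ t := fun i hi => ht (by
    rw [rootsPoly, eval_prod]
    exact Finset.prod_eq_zero (Finset.mem_univ i) (by simp [hi]))
  rw [← charpoly_diagonal_eq_rootsPoly] at ht
  have hinv : (scalar ι t - diagonal lam)⁻¹ = diagonal fun i => (t - lam i)⁻¹ := by
    refine inv_eq_right_inv ?_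
    rw [scalar_apply, diagonal_sub, diagonal_mul_diagonal, ← diagonal_one]
    congr 1
    ext i
    exact mul_inv_cancel₀ (sub_ne_zero.2 (ht' i).symm)
  have hs : ∑ i, (t - lam i)⁻¹ = -∑ i, (lam i - t)⁻¹ := by
    rw [← Finset.sum_neg_distrib]
    exact Finset.sum_congr rfl fun i _ => by rw [← inv_neg, neg_sub]
  have hq : (fun _ : ι => c) ⬝ᵥ ((diagonal fun i => (t - lam i)⁻¹) *ᵥ fun _ => c) =
      c ^ 2 * ∑ i, (t - lam i)⁻¹ := by
    simp only [dotProduct, mulVec_diagonal, Finset.mul_sum]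
    exact Finset.sum_congr rfl fun i _ => by ring
  rw [eval_charpoly_add_vecMulVec _ _ ht, hinv, hq, hs, charpoly_diagonal_eq_rootsPoly, eval_sub,
    eval_mul, eval_C, derivative_rootsPoly_eval lam ht']
  ring

end RestrictedInvertibility

/-! ### The lower barrier argument. -/

namespace RestrictedInvertibility

open Matrix Polynomial

variable {ι κ : Type*} [Fintype ι]

theorem eval_rootsPoly [Fintype κ] (lam : κ → ℝ) (t : ℝ) :
    (rootsPoly lam).eval t = ∏ i, (t - lam i) := by
  simp [rootsPoly, eval_prod]

theorem eval_derivative_derivative_rootsPoly [Fintype κ] (lam : κ → ℝ) {t : ℝ}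
    (ht : ∀ i, lam i ≠ t) :
    (derivative (derivative (rootsPoly lam))).eval t =
      (rootsPoly lam).eval t * ((∑ i, (lam i - t)⁻¹) ^ 2 - ∑ i, ((lam i - t)⁻¹) ^ 2) := by
  have h1 := (derivative (rootsPoly lam)).hasDerivAt t
  have hS : HasDerivAt (fun s => ∑ i, (lam i - s)⁻¹) (∑ i, ((lam i - t)⁻¹) ^ 2) t := by
    refine HasDerivAt.fun_sum fun i _ => ?_
    have := ((hasDerivAt_id t).const_sub (lam i)).fun_inv (sub_ne_zero.2 (ht i))
    refine this.congr_deriv ?_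
    simp
  have h2 := (((rootsPoly lam).hasDerivAt t).mul hS).neg
  have hev : (fun s => (derivative (rootsPoly lam)).eval s) =ᶠ[nhds t]
      fun s => -((rootsPoly lam).eval s * ∑ i, (lam i - s)⁻¹) := by
    have : ∀ᶠ s in nhds t, ∀ i, lam i ≠ s :=
      Filter.eventually_all.2 fun i => (eventually_ne_nhds (ht i).symm).mono fun s hs => hs.symm
    filter_upwards [this] with s hs using derivative_rootsPoly_eval lam hs
  have h3 := h1.unique (h2.congr_of_eventuallyEq hev)
  rw [h3, derivative_rootsPoly_eval lam ht]
  ring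

/-- The inequality behind the lower barrier argument. -/
theorem barrier_inequality [Fintype κ] (d : κ → ℝ) {ν φ : ℝ} (hν : 0 < ν) (hφ : 0 < φ)
    (hd : ∀ i, (ν + φ)⁻¹ < d i) (hsum : ∑ i, (d i)⁻¹ ≤ φ) :
    ∑ i, (d i - (ν + φ)⁻¹)⁻¹ -
      (∑ i, ((d i - (ν + φ)⁻¹)⁻¹) ^ 2) / (ν + ∑ i, (d i - (ν + φ)⁻¹)⁻¹) ≤ φ := by
  set δ := (ν + φ)⁻¹ with hδ
  have hδ0 : 0 < δ := by positivity
  have hd0 : ∀ i, 0 < d i := fun i => hδ0.trans (hd i)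
  have hd1 : ∀ i, 0 < d i - δ := fun i => sub_pos.2 (hd i)
  set S := ∑ i, (d i - δ)⁻¹ with hS
  set Q := ∑ i, ((d i - δ)⁻¹) ^ 2 with hQ
  set P := ∑ i, (d i)⁻¹ * (d i - δ)⁻¹ with hP
  set R := ∑ i, (d i)⁻¹ * ((d i - δ)⁻¹) ^ 2 with hR
  set φ₀ := ∑ i, (d i)⁻¹ with hφ₀
  have hS0 : 0 ≤ S := Finset.sum_nonneg fun i _ => (inv_pos.2 (hd1 i)).le
  have hR0 : 0 ≤ R := Finset.sum_nonneg fun i _ =>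
    mul_nonneg (inv_pos.2 (hd0 i)).le (sq_nonneg _)
  have hP0 : 0 ≤ P := Finset.sum_nonneg fun i _ =>
    mul_nonneg (inv_pos.2 (hd0 i)).le (inv_pos.2 (hd1 i)).le
  have e1 : S = φ₀ + δ * P := by
    rw [hS, hφ₀, hP, Finset.mul_sum, ← Finset.sum_add_distrib]
    refine Finset.sum_congr rfl fun i _ => ?_
    have := (hd0 i).ne'; have := (hd1 i).ne'
    field_simp; ring
  have e2 : Q = P + δ * R := by
    rw [hQ, hR, hP, Finset.mul_sum, ← Finset.sum_add_distrib]
    refine Finset.sum_congr rfl fun i _ => ?_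
    have := (hd0 i).ne'; have := (hd1 i).ne'
    field_simp; ring
  have e3 : P ^ 2 ≤ φ₀ * R := by
    refine Finset.sum_sq_le_sum_mul_sum_of_sq_le_mul _ (fun i _ => (inv_pos.2 (hd0 i)).le)
      (fun i _ => mul_nonneg (inv_pos.2 (hd0 i)).le (sq_nonneg _)) fun i _ => le_of_eq (by ring)
  have e4 : δ * (ν + φ) = 1 := inv_mul_cancel₀ (by positivity)
  -- After substituting `e1` and `e2`, the terms linear in `P` compare by `δ * (ν + φ₀) ≤ 1`, and
  -- the quadratic one by Cauchy-Schwarz (`e3`) with `δ * φ₀ ≤ 1`.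
  have e5 : δ * P * (ν + S) ≤ Q := by
    have h1 : δ * (ν + φ₀) ≤ 1 := by nlinarith
    have h2 : δ * φ₀ ≤ 1 := by nlinarith
    have h3 : δ * P ^ 2 ≤ R := by nlinarith
    rw [e1, e2]
    nlinarith
  have e6 : δ * P ≤ Q / (ν + S) := by rwa [le_div_iff₀ (by positivity)]
  linarith

/-- One step of the lower barrier argument for the operator `p ↦ ν p - p'`. -/
theorem exists_rootsPoly_barrier [Fintype κ] (lam : κ → ℝ) {y ν φ : ℝ} (hν : 0 < ν) (hφ : 0 < φ)
    (hlam : ∀ i, y < lam i) (hsum : ∑ i, (lam i - y)⁻¹ ≤ φ) :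
    ∃ lam' : κ → ℝ, C ν * rootsPoly lam - derivative (rootsPoly lam) = C ν * rootsPoly lam' ∧
      (∀ i, y + (ν + φ)⁻¹ < lam' i) ∧ ∑ i, (lam' i - (y + (ν + φ)⁻¹))⁻¹ ≤ φ := by
  classical
  -- Realizing the new polynomial as a characteristic polynomial of a symmetric matrix makes it
  -- real-rooted at once.
  have hH : (diagonal lam + vecMulVec (fun _ => √ν⁻¹) (fun _ => √ν⁻¹)).IsHermitian :=
    isHermitian_add_vecMulVec (isHermitian_diagonal lam) _
  have hpoly : rootsPoly hH.eigenvalues = rootsPoly lam - C ν⁻¹ * derivative (rootsPoly lam) := by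
    rw [← charpoly_eq_rootsPoly hH, charpoly_diagonal_add_vecMulVec, Real.sq_sqrt (by positivity)]
  set lam' := hH.eigenvalues
  set z := y + (ν + φ)⁻¹ with hz
  have hgap : ∀ i, (ν + φ)⁻¹ < lam i - y := by
    intro i
    have h0 : 0 < lam i - y := sub_pos.2 (hlam i)
    have h1 : (lam i - y)⁻¹ ≤ φ := (Finset.single_le_sum (f := fun i => (lam i - y)⁻¹)
      (fun j _ => (inv_pos.2 (sub_pos.2 (hlam j))).le) (Finset.mem_univ i)).trans hsum
    rw [inv_lt_comm₀ (by positivity) h0]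
    linarith
  have hzlam : ∀ i, z < lam i := fun i => by linarith [hgap i]
  have heval : ∀ t ≤ z, (rootsPoly lam').eval t =
      (rootsPoly lam).eval t * (1 + ν⁻¹ * ∑ i, (lam i - t)⁻¹) := by
    intro t ht
    rw [hpoly, eval_sub, eval_mul, eval_C,
      derivative_rootsPoly_eval lam fun i => (ht.trans_lt (hzlam i)).ne']
    ring
  have hp0 : ∀ t ≤ z, (rootsPoly lam).eval t ≠ 0 := by
    intro t ht
    rw [eval_rootsPoly, Finset.prod_ne_zero_iff]
    exact fun i _ => (sub_neg.2 (ht.trans_lt (hzlam i))).ne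
  have hS0 : ∀ t ≤ z, 0 < 1 + ν⁻¹ * ∑ i, (lam i - t)⁻¹ := by
    intro t ht
    have : 0 ≤ ∑ i, (lam i - t)⁻¹ :=
      Finset.sum_nonneg fun i _ => (inv_pos.2 (sub_pos.2 (ht.trans_lt (hzlam i)))).le
    positivity
  have hlam' : ∀ i, z < lam' i := by
    intro i
    by_contra! hle
    have h1 := heval _ hle
    have h2 : (rootsPoly lam').eval (lam' i) = 0 := by
      rw [eval_rootsPoly]
      exact Finset.prod_eq_zero (Finset.mem_univ i) (sub_self _)
    exact mul_ne_zero (hp0 _ hle) (hS0 _ hle).ne' (h1.symm.trans h2)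
  refine ⟨lam', ?_, hlam', ?_⟩
  · rw [hpoly, mul_sub, ← mul_assoc, ← C_mul, mul_inv_cancel₀ hν.ne', C_1, one_mul]
  · have key := derivative_rootsPoly_eval lam' fun i => (hlam' i).ne'
    rw [heval z le_rfl, hpoly, derivative_sub, derivative_C_mul, eval_sub, eval_mul, eval_C,
      derivative_rootsPoly_eval lam fun i => (hzlam i).ne',
      eval_derivative_derivative_rootsPoly lam fun i => (hzlam i).ne'] at key
    have hbar := barrier_inequality (fun i => lam i - y) hν hφ hgap hsum
    have hrw : ∀ i, lam i - y - (ν + φ)⁻¹ = lam i - z := fun i => by rw [hz]; ring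
    simp only [hrw] at hbar
    -- The new potential equals the left side of `barrier_inequality`: it is minus the logarithmic
    -- derivative of `p * (1 + ν⁻¹ * S)`, and `S' = Q`.
    refine le_of_eq_of_le ?_ hbar
    have hS := hS0 z le_rfl
    have hp := hp0 z le_rfl
    set S := ∑ i, (lam i - z)⁻¹
    set Q := ∑ i, ((lam i - z)⁻¹) ^ 2
    set Y := ∑ i, (lam' i - z)⁻¹
    set p := (rootsPoly lam).eval z
    have hνS : 0 < ν + S := by
      have : ν + S = ν * (1 + ν⁻¹ * S) := by field_simp
      rw [this]; positivity
    have key2 : (1 + ν⁻¹ * S) * Y = S + ν⁻¹ * (S ^ 2 - Q) :=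
      mul_left_cancel₀ hp (by linear_combination key)
    have key3 : (ν + S) * Y = ν * S + (S ^ 2 - Q) := by
      have h := congrArg (ν * ·) key2
      field_simp at h
      linear_combination h
    rw [eq_sub_iff_add_eq, ← eq_sub_iff_add_eq', div_eq_iff hνS.ne']
    linear_combination key3

/-- Applying the operators `ν i - d/dx` to `X ^ j`. -/
theorem exists_rootsPoly_prod_barrier (ν : ι → ℝ) (hν : ∀ i, 0 < ν i) (j : ℕ) {φ : ℝ}
    (hφ : 0 < φ) :
    ∃ lam : Fin j → ℝ,
      aeval (-derivative : Module.End ℝ ℝ[X]) (∏ i, (X + C (ν i))) (X ^ j) =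
        C (∏ i, ν i) * rootsPoly lam ∧
      ∀ i, -(j / φ) + ∑ i, (ν i + φ)⁻¹ + φ⁻¹ ≤ lam i := by
  classical
  suffices h : ∀ s : Finset ι, ∃ lam : Fin j → ℝ,
      aeval (-derivative : Module.End ℝ ℝ[X]) (∏ i ∈ s, (X + C (ν i))) (X ^ j) =
        C (∏ i ∈ s, ν i) * rootsPoly lam ∧
      (∀ i, -(j / φ) + ∑ i ∈ s, (ν i + φ)⁻¹ < lam i) ∧
      ∑ i, (lam i - (-(j / φ) + ∑ i ∈ s, (ν i + φ)⁻¹))⁻¹ ≤ φ by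
    obtain ⟨lam, h1, h2, h3⟩ := h Finset.univ
    refine ⟨lam, h1, fun i => ?_⟩
    -- One term of the potential is at most `φ`, so each root clears the barrier by a further `φ⁻¹`.
    -- This gain is what replaces `j` by `j - 1` in the final constant.
    have h4 : (lam i - (-(j / φ) + ∑ i, (ν i + φ)⁻¹))⁻¹ ≤ φ :=
      (Finset.single_le_sum (f := fun i => (lam i - (-(j / φ) + ∑ i, (ν i + φ)⁻¹))⁻¹)
        (fun j _ => (inv_pos.2 (sub_pos.2 (h2 j))).le) (Finset.mem_univ i)).trans h3
    have h5 := (inv_le_comm₀ (sub_pos.2 (h2 i)) hφ).1 h4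
    linarith
  intro s
  induction s using Finset.induction_on with
  | empty =>
    -- For `X ^ j` all roots are `0`; the barrier `-(j / φ)` makes the potential exactly `φ` when `j
    -- > 0`.
    refine ⟨0, by simp [rootsPoly], fun i => ?_, ?_⟩
    · have : 0 < j := i.pos
      simp only [Finset.sum_empty, add_zero, Pi.zero_apply, neg_neg_iff_pos]
      positivity
    · rcases Nat.eq_zero_or_pos j with rfl | hj
      · simp [hφ.le]
      · simp
        field_simp
        exact le_rfl
  | insert a s ha ih =>
    obtain ⟨lam, h1, h2, h3⟩ := ih
    obtain ⟨lam', h4, h5, h6⟩ := exists_rootsPoly_barrier lam (hν a) hφ h2 h3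
    have hsum : -(j / φ) + ∑ i ∈ insert a s, (ν i + φ)⁻¹ =
        -(j / φ) + ∑ i ∈ s, (ν i + φ)⁻¹ + (ν a + φ)⁻¹ := by
      rw [Finset.sum_insert ha]; ring
    refine ⟨lam', ?_, by rwa [hsum], by rwa [hsum]⟩
    rw [Finset.prod_insert ha, map_mul, Module.End.mul_apply, h1, Finset.prod_insert ha, C_mul,
      mul_comm (C (ν a)), mul_assoc, ← h4]
    generalize ∏ i ∈ s, ν i = a
    simp [Algebra.smul_def, mul_sub]
    ring

/-! ### Duality and the sign at zero. -/

/-- The commutator of a polynomial in `-d/dx` with multiplication by `X`. -/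
theorem aeval_neg_derivative_X_mul (h q : ℝ[X]) :
    aeval (-derivative : Module.End ℝ ℝ[X]) h (X * q) =
      X * aeval (-derivative : Module.End ℝ ℝ[X]) h q -
        aeval (-derivative : Module.End ℝ ℝ[X]) (derivative h) q := by
  induction h using Polynomial.induction_on with
  | C a => simp [Algebra.smul_def]; ring
  | add f g hf hg =>
    simp only [map_add, LinearMap.add_apply, hf, hg]; ring
  | monomial n a ih =>
    have hX : C a * X ^ (n + 1) = X * (C a * X ^ n) := by ring
    have hm : ∀ f g : ℝ[X], aeval (-derivative : Module.End ℝ ℝ[X]) (X * f) g =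
        -derivative (aeval (-derivative : Module.End ℝ ℝ[X]) f g) := fun f g => by
      rw [map_mul, Module.End.mul_apply, aeval_X, LinearMap.neg_apply]
    rw [hX, derivative_mul, derivative_X, one_mul, hm, hm, ih, map_add, LinearMap.add_apply, hm]
    simp only [derivative_sub, derivative_mul, derivative_X]
    ring

/-- Duality between `(1 - d/dx) ^ j` applied to `h` at `0` and `h (-d/dx)` applied to `X ^ j`
at `1`. -/
theorem eval_iterate_sub_derivative (j : ℕ) (h : ℝ[X]) :
    (((1 - derivative : Module.End ℝ ℝ[X]) ^ j) h).eval 0 =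
      (aeval (-derivative : Module.End ℝ ℝ[X]) h (X ^ j)).eval 1 := by
  induction j generalizing h with
  | zero =>
    induction h using Polynomial.induction_on' with
    | add p q hp hq => simp_all [map_add]
    | monomial n a =>
      rcases n with _ | n
      · simp [← C_mul_X_pow_eq_monomial]
      · simp [aeval_monomial, pow_succ]
  | succ j ih =>
    rw [pow_succ, Module.End.mul_apply, ih]
    rw [pow_succ', aeval_neg_derivative_X_mul]
    simp

/-- The choice of the barrier height. -/
theorem exists_barrier_height {r j : ℕ} (hj : 1 ≤ j) (hjr : j ≤ r) (ν : Fin r → ℝ)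
    (hν : ∀ i, 0 < ν i) (hsum : ∑ i, ν i < r * (√(r : ℝ) - √((j : ℝ) - 1)) ^ 2) :
    ∃ φ : ℝ, 0 < φ ∧ 1 < -(j / φ) + ∑ i, (ν i + φ)⁻¹ + φ⁻¹ := by
  set a := √(r : ℝ) with ha
  set c := √((j : ℝ) - 1) with hc
  have hj1 : (0 : ℝ) ≤ (j : ℝ) - 1 := by
    have : (1 : ℝ) ≤ j := by exact_mod_cast hj
    linarith
  have ha2 : a ^ 2 = r := Real.sq_sqrt (by positivity)
  have hc2 : c ^ 2 = (j : ℝ) - 1 := Real.sq_sqrt hj1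
  have hc0 : 0 ≤ c := Real.sqrt_nonneg _
  have hca : c < a := by
    refine Real.sqrt_lt_sqrt hj1 ?_
    have : (j : ℝ) ≤ r := by exact_mod_cast hjr
    linarith
  have hr : 0 < (r : ℝ) := by exact_mod_cast (by omega : 0 < r)
  have : NeZero r := ⟨by omega⟩
  have hν0 : 0 < ∑ i, ν i := Finset.sum_pos (fun i _ => hν i) Finset.univ_nonempty
  set s := (∑ i, ν i) / r with hs
  have hs0 : 0 < s := by positivity
  have hsum' : ∑ i, ν i = r * s := by rw [hs]; field_simp
  have hs1 : s < (a - c) ^ 2 := by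
    rw [hsum'] at hsum
    exact lt_of_mul_lt_mul_left hsum hr.le
  -- Harmonic-arithmetic mean inequality, reducing to the case of all `ν i` equal to their mean `s`.
  have hmean : ∀ φ : ℝ, 0 < φ → r / (s + φ) ≤ ∑ i, (ν i + φ)⁻¹ := by
    intro φ hφ
    have h1 := Finset.sum_sq_le_sum_mul_sum_of_sq_le_mul Finset.univ (r := fun _ : Fin r => (1 : ℝ))
      (f := fun i => ν i + φ) (g := fun i => (ν i + φ)⁻¹) (fun i _ => (add_pos (hν i) hφ).le)
      (fun i _ => (inv_pos.2 (add_pos (hν i) hφ)).le)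
      (fun i _ => by rw [mul_inv_cancel₀ (add_pos (hν i) hφ).ne', one_pow])
    simp only [Finset.sum_const, Finset.card_univ, Fintype.card_fin, nsmul_eq_mul, mul_one,
      Finset.sum_add_distrib, hsum'] at h1
    rw [div_le_iff₀ (by positivity)]
    refine le_of_mul_le_mul_left ?_ hr
    linarith
  have hsplit : ∀ φ : ℝ, -(j / φ) + ∑ i, (ν i + φ)⁻¹ + φ⁻¹ =
      ∑ i, (ν i + φ)⁻¹ - c ^ 2 / φ := by
    intro φ
    rw [hc2, sub_div, one_div]; ring
  rcases hc0.eq_or_lt with hc0 | hc0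
  · rw [← hc0, sub_zero, ha2] at hs1
    -- For `j = 1` the supremum of `r / (s + φ)` is approached as `φ → 0`; since `s < r`, this `φ`
    -- is small enough.
    refine ⟨(r - s) / 2, by linarith, ?_⟩
    rw [hsplit, ← hc0]
    have h1 := hmean ((r - s) / 2) (by linarith)
    have h2 : 1 < r / (s + (r - s) / 2) := by rw [lt_div_iff₀ (by linarith)]; linarith
    simp only [ne_eq, OfNat.ofNat_ne_zero, not_false_eq_true, zero_pow, zero_div, sub_zero]
    linarith
  · have hac : 0 < a - c := sub_pos.2 hca
    have ha0 : 0 < a := hc0.trans hca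
    -- The maximizer of `a ^ 2 / (s + φ) - c ^ 2 / φ`, where the value is `(a - c) ^ 2 / s`.
    refine ⟨s * c / (a - c), by positivity, ?_⟩
    rw [hsplit]
    have h1 := hmean (s * c / (a - c)) (by positivity)
    have h2 : (r : ℝ) / (s + s * c / (a - c)) = a * (a - c) / s := by
      rw [← ha2]
      have : s + s * c / (a - c) = s * a / (a - c) := by field_simp; ring
      rw [this]; field_simp
    have h3 : c ^ 2 / (s * c / (a - c)) = c * (a - c) / s := by field_simp
    have h4 : 1 < (a - c) ^ 2 / s := by rwa [one_lt_div hs0]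
    have h5 : a * (a - c) / s - c * (a - c) / s = (a - c) ^ 2 / s := by ring
    rw [h3]
    linarith

/-- The sign of `(1 - d/dx) ^ j` applied to the polynomial with roots `-ν i`, at `0`. -/
theorem sign_eval_iterate_rootsPoly_neg {r j : ℕ} (hj : 1 ≤ j) (hjr : j ≤ r) (ν : Fin r → ℝ)
    (hν : ∀ i, 0 < ν i) (hsum : ∑ i, ν i < r * (√(r : ℝ) - √((j : ℝ) - 1)) ^ 2) :
    0 < (-1) ^ j * (((1 - derivative : Module.End ℝ ℝ[X]) ^ j)
      (rootsPoly fun i => -ν i)).eval 0 := by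
  obtain ⟨φ, hφ, h1⟩ := exists_barrier_height hj hjr ν hν hsum
  obtain ⟨lam, h2, h3⟩ := exists_rootsPoly_prod_barrier ν hν j hφ
  have h4 : rootsPoly (fun i => -ν i) = ∏ i, (X + C (ν i)) := by
    simp [rootsPoly]
  rw [eval_iterate_sub_derivative, h4, h2, eval_mul, eval_C, eval_rootsPoly]
  have h5 : ∏ i, (1 - lam i) = (-1) ^ j * ∏ i, (lam i - 1) := by
    have := Finset.prod_mul_distrib (s := Finset.univ) (f := fun _ : Fin j => (-1 : ℝ))
      (g := fun i => lam i - 1)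
    simp only [Finset.prod_const, Finset.card_univ, Fintype.card_fin] at this
    rw [← this]
    exact Finset.prod_congr rfl fun i _ => by ring
  have h6 : 0 < ∏ i, (lam i - 1) := Finset.prod_pos fun i _ => by linarith [h3 i]
  have h7 : 0 < ∏ i, ν i := Finset.prod_pos fun i _ => hν i
  have h8 : ((-1 : ℝ) ^ j) * (-1) ^ j = 1 := by rw [← mul_pow]; simp
  rw [h5]
  calc (0 : ℝ) < (∏ i, ν i) * ∏ i, (lam i - 1) := mul_pos h7 h6
    _ = _ := by linear_combination (-(∏ i, ν i) * ∏ i, (lam i - 1)) * h8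

end RestrictedInvertibility

/-! ### Counting positive roots and greedy selection. -/

namespace RestrictedInvertibility

open Matrix Polynomial

variable {ι : Type*} [Fintype ι]

theorem posCount_eq_of_rootsPoly_eq {lam lam' : ι → ℝ} (h : rootsPoly lam = rootsPoly lam') :
    posCount lam = posCount lam' := by
  have key : ∀ l : ι → ℝ, posCount l = ((rootsPoly l).roots.filter (0 < ·)).card := by
    intro l
    have hr : (rootsPoly l).roots = Finset.univ.val.map l := by
      rw [rootsPoly, roots_prod _ _ (monic_prod_X_sub_C l Finset.univ).ne_zero]
      simp
    rw [hr, Multiset.filter_map, Multiset.card_map]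
    rfl
  rw [key, key, h]

/-- With `k` positive roots the value at `0` has sign `(-1) ^ k` or vanishes, so a strict sign of
the opposite parity excludes `k`. -/
theorem posCount_ne_of_sign {lam : ι → ℝ} {k : ℕ}
    (h : 0 < (-1) ^ (k + 1) * (rootsPoly lam).eval 0) : posCount lam ≠ k := by
  rintro rfl
  have h1 : (rootsPoly lam).eval 0 = ∏ i, if 0 < lam i then -|lam i| else |lam i| := by
    rw [eval_rootsPoly]
    refine Finset.prod_congr rfl fun i _ => ?_
    split_ifs with hi
    · rw [abs_of_pos hi, zero_sub]
    · rw [abs_of_nonpos (not_lt.1 hi), zero_sub]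
  have h2 : (rootsPoly lam).eval 0 = (-1) ^ posCount lam * ∏ i, |lam i| := by
    rw [h1, posCount, ← Finset.prod_const, Finset.prod_filter, ← Finset.prod_mul_distrib]
    exact Finset.prod_congr rfl fun i _ => by split_ifs <;> simp
  have h3 : 0 ≤ ∏ i, |lam i| := Finset.prod_nonneg fun i _ => abs_nonneg _
  rw [h2, ← mul_assoc, ← pow_add] at h
  have h4 : (-1 : ℝ) ^ (posCount lam + 1 + posCount lam) = -1 :=
    Odd.neg_one_pow ⟨posCount lam, by ring⟩
  rw [h4] at h
  linarith

variable [DecidableEq ι]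

/-- The roots of `p - p'`, where `p` has roots `lam`. -/
noncomputable def shiftRoots (lam : ι → ℝ) : ι → ℝ :=
  (isHermitian_add_vecMulVec (isHermitian_diagonal lam) fun _ => 1).eigenvalues

theorem rootsPoly_shiftRoots (lam : ι → ℝ) :
    rootsPoly (shiftRoots lam) = (1 - derivative : Module.End ℝ ℝ[X]) (rootsPoly lam) := by
  rw [shiftRoots, ← charpoly_eq_rootsPoly, charpoly_diagonal_add_vecMulVec]
  simp

/-- Since `shiftRoots` gives the eigenvalues of a diagonal matrix plus a fixed rank-one matrix,
Weyl's principle applies. This takes the place of an interlacing argument. -/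
theorem shiftRoots_mono : Monotone (shiftRoots : (ι → ℝ) → ι → ℝ) := by
  intro lam lam' h
  refine eigenvalues_mono _ _ fun x => ?_
  rw [add_mulVec, add_mulVec, dotProduct_add, dotProduct_add]
  refine add_le_add_left (Finset.sum_le_sum fun i _ => ?_) _
  rw [mulVec_diagonal, mulVec_diagonal]
  nlinarith [mul_le_mul_of_nonneg_right (h i) (mul_self_nonneg (x i))]

theorem posCount_eigenvalues_diagonal (lam : ι → ℝ) :
    posCount (isHermitian_diagonal lam).eigenvalues = posCount lam :=
  posCount_eq_of_rootsPoly_eq (by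
    rw [← charpoly_eq_rootsPoly, charpoly_diagonal_eq_rootsPoly])

theorem posCount_le_shiftRoots (lam : ι → ℝ) : posCount lam ≤ posCount (shiftRoots lam) :=
  (posCount_eigenvalues_diagonal lam).symm.trans_le
    (posCount_mono (eigenvalues_le_add_vecMulVec (isHermitian_diagonal lam) _))

theorem posCount_shiftRoots_le (lam : ι → ℝ) : posCount (shiftRoots lam) ≤ posCount lam + 1 := by
  refine (posCount_add_vecMulVec_le (isHermitian_diagonal lam) _).trans_eq ?_
  rw [posCount_eigenvalues_diagonal]

theorem posCount_iterate_shiftRoots_le (l : ℕ) (lam : ι → ℝ) :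
    posCount (shiftRoots^[l] lam) ≤ posCount lam + l := by
  induction l with
  | zero => simp
  | succ l ih =>
    rw [Function.iterate_succ_apply']
    have := posCount_shiftRoots_le (shiftRoots^[l] lam)
    omega

theorem rootsPoly_iterate_shiftRoots (l : ℕ) (lam : ι → ℝ) :
    rootsPoly (shiftRoots^[l] lam) =
      ((1 - derivative : Module.End ℝ ℝ[X]) ^ l) (rootsPoly lam) := by
  induction l with
  | zero => simp
  | succ l ih =>
    rw [Function.iterate_succ_apply', rootsPoly_shiftRoots, ih, pow_succ', Module.End.mul_apply]

/-- Greedy selection of isotropic rank-one updates. -/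
theorem exists_list_posCount {α : Type*} [Fintype α] {p : α → ℝ} {u : α → ι → ℝ}
    (hp0 : ∀ c, 0 ≤ p c) (hp : ∑ c, p c = 1) (hu : ∑ c, p c • vecMulVec (u c) (u c) = 1)
    {k : ℕ} (l : ℕ) {A : Matrix ι ι ℝ} (hA : A.IsHermitian)
    (hpos : posCount hA.eigenvalues + l ≤ k)
    (hcount : posCount (shiftRoots^[l] hA.eigenvalues) = k)
    (hsign : 0 < (-1) ^ k * (((1 - derivative : Module.End ℝ ℝ[X]) ^ l) A.charpoly).eval 0) :
    ∃ c : List α, c.length = l ∧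
      ∃ hB : (A + (c.map fun a => vecMulVec (u a) (u a)).sum).IsHermitian,
        posCount hB.eigenvalues = k := by
  induction l generalizing A with
  | zero =>
    refine ⟨[], rfl, ?_⟩
    rw [List.map_nil, List.sum_nil, add_zero]
    exact ⟨hA, hcount⟩
  | succ l ih =>
    have hsum : ∑ c, p c * ((-1) ^ k * (((1 - derivative : Module.End ℝ ℝ[X]) ^ l)
        (A + vecMulVec (u c) (u c)).charpoly).eval 0) =
        (-1) ^ k * (((1 - derivative : Module.End ℝ ℝ[X]) ^ (l + 1)) A.charpoly).eval 0 := by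
      have h1 : (1 - derivative : Module.End ℝ ℝ[X]) A.charpoly =
          ∑ c, p c • (A + vecMulVec (u c) (u c)).charpoly := by
        simpa [smul_eq_C_mul] using (sum_charpoly_add_vecMulVec A p u hp hu).symm
      rw [pow_succ, Module.End.mul_apply, h1, map_sum, eval_finsetSum, Finset.mul_sum]
      refine Finset.sum_congr rfl fun c _ => ?_
      rw [map_smul, eval_smul, smul_eq_mul]
      ring
    rw [← hsum] at hsign
    obtain ⟨c, -, hc⟩ := Finset.exists_lt_of_sum_lt (s := Finset.univ) (f := fun _ : α => (0 : ℝ))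
      (by simpa using hsign)
    have hc' := pos_of_mul_pos_right hc (hp0 c)
    have hB := isHermitian_add_vecMulVec hA (u c)
    have h1 := posCount_add_vecMulVec_le hA (u c)
    have h2 := posCount_iterate_shiftRoots_le l hB.eigenvalues
    have h3 : posCount (shiftRoots^[l] hA.eigenvalues) ≤ posCount (shiftRoots^[l] hB.eigenvalues) :=
      posCount_mono (shiftRoots_mono.iterate l (eigenvalues_le_add_vecMulVec hA (u c)))
    have h4 := posCount_shiftRoots_le (shiftRoots^[l] hA.eigenvalues)
    rw [← Function.iterate_succ_apply' shiftRoots, hcount] at h4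
    -- Monotonicity gives at least `k - 1` positive roots and the rank-one count at most `k`; the
    -- sign kept by the choice of `c` rules out `k - 1`.
    have h5 : posCount (shiftRoots^[l] hB.eigenvalues) = k := by
      have h6 : posCount (shiftRoots^[l] hB.eigenvalues) ≠ k - 1 := by
        refine posCount_ne_of_sign ?_
        rw [Nat.sub_add_cancel (by omega), rootsPoly_iterate_shiftRoots, ← charpoly_eq_rootsPoly]
        exact hc'
      omega
    obtain ⟨c', hlen, hH, hk⟩ := ih hB (by omega) h5 hc'
    have hadd : A + ((c :: c').map fun a => vecMulVec (u a) (u a)).sum =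
        A + vecMulVec (u c) (u c) + (c'.map fun a => vecMulVec (u a) (u a)).sum := by
      rw [List.map_cons, List.sum_cons, add_assoc]
    refine ⟨c :: c', by simp [hlen], ?_⟩
    rw [hadd]
    exact ⟨hH, hk⟩

theorem exists_list_posCount_neg_diagonal {α : Type*} [Fintype α] {r k : ℕ} (hk : 1 ≤ k)
    (hkr : k ≤ r) {p : α → ℝ} {u : α → Fin r → ℝ}
    (hp0 : ∀ c, 0 ≤ p c) (hp : ∑ c, p c = 1) (hu : ∑ c, p c • vecMulVec (u c) (u c) = 1)
    {ν : Fin r → ℝ} (hν : ∀ i, 0 < ν i)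
    (hsum : ∑ i, ν i < r * (√(r : ℝ) - √((k : ℝ) - 1)) ^ 2) :
    ∃ c : List α, c.length = k ∧
      ∃ hB : (diagonal (fun i => -ν i) + (c.map fun a => vecMulVec (u a) (u a)).sum).IsHermitian,
        posCount hB.eigenvalues = k := by
  have hA := isHermitian_diagonal (n := Fin r) fun i => -ν i
  have hroots : rootsPoly hA.eigenvalues = rootsPoly fun i => -ν i := by
    rw [← charpoly_eq_rootsPoly, charpoly_diagonal_eq_rootsPoly]
  have hpos0 : posCount hA.eigenvalues = 0 := by
    rw [posCount_eigenvalues_diagonal, posCount, Finset.card_eq_zero]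
    exact Finset.filter_eq_empty_iff.2 fun i _ => by linarith [hν i]
  have hsign : ∀ j, 1 ≤ j → j ≤ k → 0 < (-1) ^ j * (((1 - derivative : Module.End ℝ ℝ[X]) ^ j)
      (rootsPoly hA.eigenvalues)).eval 0 := by
    intro j hj hjk
    rw [hroots]
    refine sign_eval_iterate_rootsPoly_neg hj (hjk.trans hkr) ν hν (hsum.trans_le ?_)
    have h1 : √((j : ℝ) - 1) ≤ √((k : ℝ) - 1) :=
      Real.sqrt_le_sqrt (by simpa using (Nat.cast_le (α := ℝ)).2 hjk)
    have h2 : √((k : ℝ) - 1) ≤ √(r : ℝ) := by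
      refine Real.sqrt_le_sqrt ?_
      have : (k : ℝ) ≤ r := by exact_mod_cast hkr
      linarith
    gcongr
  -- Each application of `1 - d/dx` adds zero or one positive root, and the alternating sign
  -- excludes zero. This needs the sign for every `j ≤ k`, available because the constant decreases
  -- in `j`.
  have hcount : ∀ j ≤ k, posCount (shiftRoots^[j] hA.eigenvalues) = j := by
    intro j
    induction j with
    | zero => intro _; simpa using hpos0
    | succ j ih =>
      intro hj
      have h1 := ih (by omega)
      have h2 := posCount_shiftRoots_le (shiftRoots^[j] hA.eigenvalues)
      have h3 := posCount_le_shiftRoots (shiftRoots^[j] hA.eigenvalues)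
      rw [← Function.iterate_succ_apply' shiftRoots, Nat.succ_eq_add_one] at h2 h3
      have h4 : posCount (shiftRoots^[j + 1] hA.eigenvalues) ≠ j :=
        posCount_ne_of_sign (by
          rw [rootsPoly_iterate_shiftRoots]
          exact hsign (j + 1) (by omega) hj)
      omega
  refine exists_list_posCount hp0 hp hu k hA (by omega) (hcount k le_rfl) ?_
  rw [charpoly_eq_rootsPoly hA]
  exact hsign k hk le_rfl

end RestrictedInvertibility

/-! ### From positive eigenvalues to a lower bound on singular values. -/

namespace RestrictedInvertibility

open Matrix

/-- A symmetric matrix is positive definite on the span of its positive eigenvectors. -/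
theorem exists_linearMap_posDef {ι : Type*} [Fintype ι] [DecidableEq ι] {B : Matrix ι ι ℝ}
    (hB : B.IsHermitian) :
    ∃ G : ({i // 0 < hB.eigenvalues i} → ℝ) →ₗ[ℝ] (ι → ℝ),
      ∀ y, y ≠ 0 → 0 < G y ⬝ᵥ (B *ᵥ G y) := by
  let ext0 : ({i // 0 < hB.eigenvalues i} → ℝ) →ₗ[ℝ] EuclideanSpace ℝ ι :=
    { toFun := fun y => WithLp.toLp 2 fun i => if h : 0 < hB.eigenvalues i then y ⟨i, h⟩ else 0
      map_add' := fun y z => by ext i; by_cases h : 0 < hB.eigenvalues i <;> simp [h]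
      map_smul' := fun a y => by ext i; by_cases h : 0 < hB.eigenvalues i <;> simp [h] }
  refine ⟨(WithLp.linearEquiv 2 ℝ (ι → ℝ)).toLinearMap ∘ₗ
    hB.eigenvectorBasis.repr.symm.toLinearEquiv.toLinearMap ∘ₗ ext0, fun y hy => ?_⟩
  have h1 := dotProduct_mulVec_eq_sum_eigenvalues hB (hB.eigenvectorBasis.repr.symm (ext0 y))
  simp only [LinearIsometryEquiv.apply_symm_apply] at h1
  refine lt_of_lt_of_eq ?_ h1.symm
  obtain ⟨⟨i, hi⟩, hyi⟩ := Function.ne_iff.1 hy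
  refine Finset.sum_pos' (fun j _ => ?_) ⟨i, Finset.mem_univ i, ?_⟩
  · by_cases h : 0 < hB.eigenvalues j
    · exact mul_nonneg h.le (sq_nonneg _)
    · simp [ext0, h]
  · have : ext0 y i = y ⟨i, hi⟩ := by simp [ext0, hi]
    rw [this]
    have : y ⟨i, hi⟩ ≠ 0 := hyi
    positivity

theorem exists_subset_of_isotropic {α : Type*} [Fintype α] [DecidableEq α] {r k : ℕ}
    (hk : 1 ≤ k) (hkr : k ≤ r) {p : α → ℝ} {v : α → Fin r → ℝ} (hp : ∀ c, 0 ≤ p c)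
    (hp0 : 0 < ∑ c, p c) (hv : ∑ c, p c • vecMulVec (v c) (v c) = 1)
    {σ : Fin r → ℝ} (hσ : ∀ i, 0 < σ i) {b : ℝ} (hb : 0 < b)
    (hsum : b * ∑ i, (σ i ^ 2)⁻¹ < r * (√(r : ℝ) - √((k : ℝ) - 1)) ^ 2) :
    ∃ S : Finset α, S.card = k ∧ ∀ z : α → ℝ,
      b * ∑ c ∈ S, z c ^ 2 ≤ (∑ c, p c) * ∑ i, (σ i * ∑ c ∈ S, z c * v c i) ^ 2 := by
  set Z := ∑ c, p c with hZ
  have hu : ∑ c, (p c / Z) • vecMulVec (√Z • v c) (√Z • v c) = 1 := by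
    rw [← hv]
    refine Finset.sum_congr rfl fun c _ => ?_
    rw [smul_vecMulVec, vecMulVec_smul, smul_smul, smul_smul]
    congr 1
    rw [mul_assoc, Real.mul_self_sqrt hp0.le, div_mul_cancel₀ _ hp0.ne']
  obtain ⟨c, hlen, hB, hcount⟩ := exists_list_posCount_neg_diagonal hk hkr
    (p := fun c => p c / Z) (u := fun c => √Z • v c) (ν := fun i => b * (σ i ^ 2)⁻¹)
    (fun c => div_nonneg (hp c) hp0.le)
    (by rw [← Finset.sum_div, div_self hp0.ne']) hu
    (fun i => by have := hσ i; positivity) (by rwa [← Finset.mul_sum])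
  obtain ⟨G, hG⟩ := exists_linearMap_posDef hB
  have hform : ∀ x : Fin r → ℝ, x ⬝ᵥ ((diagonal (fun i => -(b * (σ i ^ 2)⁻¹)) +
      (c.map fun a => vecMulVec (√Z • v a) (√Z • v a)).sum) *ᵥ x) =
      Z * (c.map fun a => (v a ⬝ᵥ x) ^ 2).sum - b * ∑ i, (σ i ^ 2)⁻¹ * x i ^ 2 := by
    intro x
    have h1 : ∀ l : List α, x ⬝ᵥ ((l.map fun a => vecMulVec (√Z • v a) (√Z • v a)).sum *ᵥ x) =
        Z * (l.map fun a => (v a ⬝ᵥ x) ^ 2).sum := by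
      intro l
      induction l with
      | nil => simp
      | cons a l ih =>
        rw [List.map_cons, List.sum_cons, add_mulVec, dotProduct_add, ih, List.map_cons,
          List.sum_cons, dotProduct_vecMulVec_mulVec, smul_dotProduct, smul_eq_mul, mul_pow,
          Real.sq_sqrt hp0.le, mul_add]
    have h2 : x ⬝ᵥ (diagonal (fun i => -(b * (σ i ^ 2)⁻¹)) *ᵥ x) =
        -(b * ∑ i, (σ i ^ 2)⁻¹ * x i ^ 2) := by
      rw [Finset.mul_sum, ← Finset.sum_neg_distrib]
      refine Finset.sum_congr rfl fun i _ => ?_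
      rw [mulVec_diagonal]; ring
    rw [add_mulVec, dotProduct_add, h1, h2]
    ring
  have hN : ∀ x : Fin r → ℝ, 0 ≤ b * ∑ i, (σ i ^ 2)⁻¹ * x i ^ 2 := fun x =>
    mul_nonneg hb.le (Finset.sum_nonneg fun i _ => by positivity)
  let S := c.toFinset
  let L : ({i // 0 < hB.eigenvalues i} → ℝ) →ₗ[ℝ] (S → ℝ) :=
    { toFun := fun y a => v a ⬝ᵥ G y
      map_add' := fun y z => by ext a; simp [dotProduct_add]
      map_smul' := fun t y => by ext a; simp [dotProduct_smul] }
  -- Where all `v a ⬝ᵥ G y` vanish, only the nonpositive diagonal part of the form survives, so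
  -- positivity forces `y = 0`.
  have hinj : Function.Injective L := by
    rw [injective_iff_map_eq_zero]
    intro y hy
    by_contra hy0
    have h1 := hG y hy0
    rw [hform] at h1
    have h2 : (c.map fun a => (v a ⬝ᵥ G y) ^ 2).sum = 0 := by
      refine List.sum_eq_zero fun t ht => ?_
      obtain ⟨a, ha, rfl⟩ := List.mem_map.1 ht
      have := congrFun hy ⟨a, List.mem_toFinset.2 ha⟩
      change v a ⬝ᵥ G y = 0 at this
      rw [this]; simp
    rw [h2] at h1
    linarith [hN (G y)]
  have hdom : Module.finrank ℝ ({i // 0 < hB.eigenvalues i} → ℝ) = k := by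
    rw [Module.finrank_fintype_fun_eq_card, Fintype.card_subtype, ← hcount]
    rfl
  have hcod : Module.finrank ℝ (S → ℝ) = S.card := by simp
  have hle : S.card ≤ k := hlen ▸ List.toFinset_card_le c
  have hge := LinearMap.finrank_le_finrank_of_injective hinj
  have hS : S.card = k := by omega
  have hsurj := (LinearMap.injective_iff_surjective_of_finrank_eq_finrank
    (by rw [hdom, hcod, hS])).1 hinj
  -- The greedy list could have repeated indices; injectivity of `L` from dimension `k` leaves no
  -- room for them.
  have hnodup : c.Nodup :=
    (Multiset.toFinset_card_eq_card_iff_nodup (m := (c : Multiset α))).1 (hS.trans hlen.symm)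
  refine ⟨S, hS, fun z => ?_⟩
  obtain ⟨y, hy⟩ := hsurj fun a => z a
  set x := G y
  have hz : ∀ a ∈ S, v a ⬝ᵥ x = z a := fun a ha => congrFun hy ⟨a, ha⟩
  have hq : b * ∑ i, (σ i ^ 2)⁻¹ * x i ^ 2 ≤ Z * ∑ a ∈ S, z a ^ 2 := by
    have h1 : (c.map fun a => (v a ⬝ᵥ x) ^ 2).sum = ∑ a ∈ S, z a ^ 2 := by
      rw [← List.sum_toFinset _ hnodup]
      exact Finset.sum_congr rfl fun a ha => by rw [hz a ha]
    rw [← h1]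
    by_cases hy0 : y = 0
    · have : x = 0 := by simp [x, hy0]
      simp [this]
    · have h2 := hG y hy0
      rw [hform] at h2
      linarith
  -- Pairing `∑ z a • v a` with `x` returns `‖z‖²`; inserting `σ i * (σ i)⁻¹` prepares
  -- Cauchy-Schwarz against the bound `hq` on `x`.
  have hin : ∑ a ∈ S, z a ^ 2 = ∑ i, (σ i * ∑ a ∈ S, z a * v a i) * ((σ i)⁻¹ * x i) := by
    have h1 : ∀ i, (σ i * ∑ a ∈ S, z a * v a i) * ((σ i)⁻¹ * x i) =
        ∑ a ∈ S, z a * (v a i * x i) := fun i => by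
      have := (hσ i).ne'
      field_simp
      rw [Finset.sum_mul]
      exact Finset.sum_congr rfl fun a _ => by ring
    simp only [h1]
    rw [Finset.sum_comm]
    refine Finset.sum_congr rfl fun a ha => ?_
    rw [← Finset.mul_sum, sq]
    congr 1
    exact (hz a ha).symm
  have hcs := Finset.sum_mul_sq_le_sq_mul_sq Finset.univ
    (fun i => σ i * ∑ a ∈ S, z a * v a i) fun i => (σ i)⁻¹ * x i
  rw [← hin] at hcs
  simp only [mul_pow (_)⁻¹, inv_pow] at hcs
  set q := ∑ a ∈ S, z a ^ 2
  set N := ∑ i, (σ i ^ 2)⁻¹ * x i ^ 2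
  set V := ∑ i, (σ i * ∑ a ∈ S, z a * v a i) ^ 2
  have hV : 0 ≤ V := Finset.sum_nonneg fun i _ => sq_nonneg _
  have hq0 : 0 ≤ q := Finset.sum_nonneg fun i _ => sq_nonneg _
  rcases hq0.eq_or_lt with hq0 | hq0
  · rw [← hq0, mul_zero]; positivity
  · refine le_of_mul_le_mul_right ?_ hq0
    calc b * q * q = b * q ^ 2 := by ring
      _ ≤ b * (V * N) := mul_le_mul_of_nonneg_left hcs hb.le
      _ = V * (b * N) := by ring
      _ ≤ V * (Z * q) := mul_le_mul_of_nonneg_left hq hV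
      _ = Z * V * q := by ring

theorem norm_sq_eq_sum_singularValues {E F : Type*} [NormedAddCommGroup E] [InnerProductSpace ℝ E]
    [FiniteDimensional ℝ E] [NormedAddCommGroup F] [InnerProductSpace ℝ F] [FiniteDimensional ℝ F]
    (T : E →ₗ[ℝ] F) {m : ℕ} (hm : Module.finrank ℝ E = m) (x : E) :
    ‖T x‖ ^ 2 = ∑ i : Fin m, T.singularValues i ^ 2 *
      ((T.isSymmetric_adjoint_comp_self.eigenvectorBasis hm).repr x i) ^ 2 := by
  set e := T.isSymmetric_adjoint_comp_self.eigenvectorBasis hm with he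
  have h1 : ‖T x‖ ^ 2 = inner ℝ x ((LinearMap.adjoint T ∘ₗ T) x) := by
    rw [LinearMap.comp_apply, LinearMap.adjoint_inner_right, real_inner_self_eq_norm_sq]
  rw [h1, ← e.repr.inner_map_map, PiLp.inner_apply]
  refine Finset.sum_congr rfl fun i _ => ?_
  rw [he, T.isSymmetric_adjoint_comp_self.eigenvectorBasis_apply_self_apply,
    T.sq_singularValues_fin hm]
  simp
  ring

theorem frobeniusNorm_inv_sq_of_isDiag {m : ℕ} {W : Matrix (Fin m) (Fin m) ℝ} (hW : W.IsDiag)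
    (hW0 : ∀ i, W i i ≠ 0) : frobeniusNorm W⁻¹ ^ 2 = ∑ i, (W i i ^ 2)⁻¹ := by
  have hinv : W⁻¹ = diagonal fun i => (W i i)⁻¹ := by
    refine inv_eq_right_inv ?_
    nth_rw 1 [← hW.diagonal_diag]
    rw [diagonal_mul_diagonal, ← diagonal_one]
    congr 1
    ext i
    exact mul_inv_cancel₀ (hW0 i)
  rw [hinv, frobeniusNorm, frobenius_norm_diagonal, EuclideanSpace.norm_sq_eq]
  simp

theorem toEuclideanLin_columns_mul_principal {n m : ℕ} (A : Matrix (Fin n) (Fin m) ℝ)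
    {W : Matrix (Fin m) (Fin m) ℝ} (hW : W.IsDiag) (S : Finset (Fin m)) (z : EuclideanSpace ℝ S) :
    toEuclideanLin (columns A S * principal W S) z = toEuclideanLin A
      (WithLp.toLp 2 fun c => if h : c ∈ S then W c c * z ⟨c, h⟩ else 0) := by
  have h1 : principal W S *ᵥ z.ofLp = fun c : S => W c c * z c := by
    have : principal W S = diagonal fun c : S => W c c := by
      ext c d
      by_cases h : c = d
      · simp [h, principal]
      · rw [diagonal_apply_ne _ h]
        exact hW fun h' => h (Subtype.ext h')
    ext c
    rw [this, mulVec_diagonal]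
  ext i
  simp only [toLpLin_apply, ← mulVec_mulVec, h1]
  simp only [mulVec, dotProduct, columns, submatrix_apply, id]
  rw [← Finset.sum_subset (Finset.subset_univ S) (fun c _ hc => by simp [hc]),
    ← Finset.sum_coe_sort S]
  exact Finset.sum_congr rfl fun c _ => by simp

theorem exists_subset_norm_sq_le {n m : ℕ} (A : Matrix (Fin n) (Fin m) ℝ)
    (W : Matrix (Fin m) (Fin m) ℝ) (hW : W.IsDiag) (hW0 : ∀ i, W i i ≠ 0)
    (k r : ℕ) (hk : 1 ≤ k) (hkr : k ≤ r) (hr : r ≤ A.rank) {b : ℝ} (hb : 0 < b)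
    (hsum : b * ∑ i ∈ Finset.range r, (singularValue A i ^ 2)⁻¹ <
      r * (√(r : ℝ) - √((k : ℝ) - 1)) ^ 2) :
    ∃ S : Finset (Fin m), S.card = k ∧ ∀ z : EuclideanSpace ℝ S, b * ‖z‖ ^ 2 ≤
      frobeniusNorm W⁻¹ ^ 2 * ‖toEuclideanLin (columns A S * principal W S) z‖ ^ 2 := by
  have hrm : r ≤ m := hr.trans (by simpa using A.rank_le_width)
  have hm : Module.finrank ℝ (EuclideanSpace ℝ (Fin m)) = m := by simp
  set T := toEuclideanLin A with hT
  set e := T.isSymmetric_adjoint_comp_self.eigenvectorBasis hm with he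
  rw [frobeniusNorm_inv_sq_of_isDiag hW hW0]
  have hσ : ∀ i : Fin r, 0 < singularValue A i := fun i => by
    rw [singularValue, LinearMap.singularValues_pos_iff_lt_finrank_range]
    refine i.2.trans_le (hr.trans_eq ?_)
    rw [toEuclideanLin_eq_toLin_orthonormal]
    exact rank_eq_finrank_range_toLin A _ _
  have hm0 : 0 < m := by omega
  have : NeZero m := ⟨by omega⟩
  -- The weights cancel the factors `W c c`, leaving the orthonormality of `r` right singular
  -- vectors.
  have hv : ∑ c, (W c c ^ 2)⁻¹ • vecMulVec (fun i : Fin r => W c c * e (Fin.castLE hrm i) c)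
      (fun i : Fin r => W c c * e (Fin.castLE hrm i) c) = 1 := by
    ext i j
    have h1 := e.inner_eq_ite (Fin.castLE hrm i) (Fin.castLE hrm j)
    rw [PiLp.inner_apply] at h1
    rw [Matrix.sum_apply, Matrix.one_apply]
    simp only [Fin.castLE_inj] at h1
    rw [← h1]
    refine Finset.sum_congr rfl fun c _ => ?_
    have := hW0 c
    simp [vecMulVec_apply]
    field_simp
  obtain ⟨S, hS, h⟩ := exists_subset_of_isotropic hk hkr
    (p := fun c => (W c c ^ 2)⁻¹) (fun c => by positivity)
    (Finset.sum_pos (fun c _ => by have := hW0 c; positivity) Finset.univ_nonempty) hv hσ hb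
    (by rwa [Finset.sum_range] at hsum)
  refine ⟨S, hS, fun z => ?_⟩
  have hz := h fun c => if hc : c ∈ S then z ⟨c, hc⟩ else 0
  have hzn : ∑ c ∈ S, (if hc : c ∈ S then z ⟨c, hc⟩ else 0) ^ 2 = ‖z‖ ^ 2 := by
    rw [EuclideanSpace.norm_sq_eq, ← Finset.sum_coe_sort S]
    exact Finset.sum_congr rfl fun c _ => by simp
  rw [hzn] at hz
  refine hz.trans (mul_le_mul_of_nonneg_left ?_ (Finset.sum_nonneg fun c _ => by positivity))
  rw [toEuclideanLin_columns_mul_principal A hW, ← hT, norm_sq_eq_sum_singularValues T hm, ← he]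
  set g : EuclideanSpace ℝ (Fin m) :=
    WithLp.toLp 2 fun c => if h : c ∈ S then W c c * z ⟨c, h⟩ else 0 with hg
  have hterm : ∀ i : Fin r, (singularValue A i * ∑ c ∈ S, (if hc : c ∈ S then z ⟨c, hc⟩ else 0) *
      (W c c * e (Fin.castLE hrm i) c)) ^ 2 =
      T.singularValues (Fin.castLE hrm i) ^ 2 * (e.repr g (Fin.castLE hrm i)) ^ 2 := by
    intro i
    rw [mul_pow, e.repr_apply_apply, PiLp.inner_apply,
      ← Finset.sum_subset (Finset.subset_univ S) (fun c _ hc => by simp [hg, hc])]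
    congr 2
    refine Finset.sum_congr rfl fun c hc => ?_
    simp [hg, hc]
    ring
  rw [Finset.sum_congr rfl fun i _ => hterm i]
  have hinjc : Function.Injective (Fin.castLE hrm) := Fin.castLE_injective hrm
  rw [← Finset.sum_image (s := Finset.univ) (g := Fin.castLE hrm)
    (f := fun i : Fin m => T.singularValues i ^ 2 * (e.repr g i) ^ 2) (fun _ _ _ _ h => hinjc h)]
  -- Discarding the singular directions beyond the first `r` only decreases the norm.
  exact Finset.sum_le_sum_of_subset_of_nonneg (Finset.subset_univ _) fun _ _ _ => by positivity

end RestrictedInvertibility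

open RestrictedInvertibility in
theorem theorem1p1 {n m : ℕ} (A : Matrix (Fin n) (Fin m) ℝ) (W : Matrix (Fin m) (Fin m) ℝ)
    (hW : W.IsDiag) (hW0 : ∀ i, W i i ≠ 0)
    (k r : ℕ) (hk : 1 ≤ k) (hkr : k ≤ r) (hr : r ≤ A.rank) :
    ∃ S : Finset (Fin m), S.card = k ∧
      (√(r : ℝ) - √((k : ℝ) - 1)) ^ 2 / frobeniusNorm W⁻¹ ^ 2 *
          ((r : ℝ) / ∑ i ∈ Finset.range r, (singularValue A i ^ 2)⁻¹)
        ≤ sigmaMin (columns A S * principal W S) ^ 2 := by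
  set Z := frobeniusNorm W⁻¹ ^ 2 with hZ
  set Q := ∑ i ∈ Finset.range r, (singularValue A i ^ 2)⁻¹ with hQ
  have hZ0 : 0 ≤ Z := sq_nonneg _
  have hQ0 : 0 ≤ Q := Finset.sum_nonneg fun i _ => by positivity
  have hkm : k ≤ m := hkr.trans (hr.trans (by simpa using A.rank_le_width))
  -- The selection needs a strict inequality, so it reaches only values `t` below the bound, with a
  -- subset depending on `t`. A maximizing `S` serves all `t` at once.
  obtain ⟨S, hS, hmax⟩ := Finset.exists_max_image
    (Finset.powersetCard k (Finset.univ : Finset (Fin m)))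
    (fun S => sigmaMin (columns A S * principal W S) ^ 2)
    (Finset.powersetCard_nonempty.2 (by simp [hkm]))
  refine ⟨S, (Finset.mem_powersetCard.1 hS).2, le_of_forall_lt_imp_le_of_dense fun t ht => ?_⟩
  rcases le_or_gt t 0 with ht0 | ht0
  · exact ht0.trans (sq_nonneg _)
  -- If `Z` or `Q` were `0`, division by zero would make the bound `0`, contradicting `0 < t`.
  have hZpos : 0 < Z := hZ0.lt_of_ne fun h => by
    rw [← h] at ht; simp at ht; linarith
  have hQpos : 0 < Q := hQ0.lt_of_ne fun h => by
    rw [← h] at ht; simp at ht; linarith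
  obtain ⟨S', hS', h⟩ := exists_subset_norm_sq_le A W hW hW0 k r hk hkr hr
    (b := t * Z) (by positivity) (by
      rw [div_mul_div_comm, lt_div_iff₀ (by positivity)] at ht
      linarith)
  refine le_trans ?_ (hmax S' (Finset.mem_powersetCard.2 ⟨Finset.subset_univ _, hS'⟩))
  have hne : Nonempty S' := (Finset.card_pos.1 (by omega)).coe_sort
  have : Nonempty (Metric.sphere (0 : EuclideanSpace ℝ S') 1) :=
    (NormedSpace.sphere_nonempty.2 zero_le_one).coe_sort
  have hle : √t ≤ sigmaMin (columns A S' * principal W S') := by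
    refine le_ciInf fun x => Real.sqrt_le_iff.2 ⟨norm_nonneg _, ?_⟩
    have hx : ‖(x : EuclideanSpace ℝ S')‖ = 1 := by simp
    have := h x
    rw [hx, one_pow, mul_one, mul_comm] at this
    exact le_of_mul_le_mul_left this hZpos
  calc t = √t ^ 2 := (Real.sq_sqrt ht0.le).symm
    _ ≤ _ := pow_le_pow_left₀ (Real.sqrt_nonneg t) hle 2
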